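/- Let $G=(V,E)$ be a finite tree and let $\Delta^{*}(u,v)$ be the graph distance of $G$. Call a two-element subset $\{u,v\}\subset V$ a couple; it is labelled similar ($y^{*}=+1$) if $\Delta^{*}(u,v)<\theta:=1.5$ (i.e. $\{u,v\}\in E$) and dissimilar ($y^{*}=-1$) if $\Delta^{*}(u,v)>\theta$. Let $s:\mathbb{R}_{\ge 0}\to\mathbb{R}$ be non-decreasing, convex and not constant (for example $s(x)=x^{\gamma}$ with $\gamma\ge 1$). For a space $Z$ with distance function $d_Z$, a threshold $\theta_Z$ and a map $\varphi:V\to Z$, the couple $\{u,v\}$ satisfies the margin condition if $$y^{*}(\{u,v\})=+1\Rightarrow s(d_Z(\varphi(u),\varphi(v)))\le s(\theta_Z)-1,\qquad y^{*}(\{u,v\})=-1\Rightarrow s(d_Z(\varphi(u),\varphi(v)))\ge s(\theta_Z)+1 .$$ Let $v_{\min}(Z)$ be the minimum, over all maps $\varphi:V\to Z$, of the number of couples that violate the margin condition. Let $\mathcal{B}[R;\mathbb{H}^{n}]$ be the closed ball of radius $R$ in the $n$-dimensional hyperbolic space of curvature $-1$, with the hyperbolic distance. Then there exist a radius $R\in\mathbb{R}_{\ge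 0}$ and a threshold $\theta_Z\in[0,2R]$, both independent of $n$, such that $v_{\min}(\mathcal{B}[R;\mathbb{H}^{n}])=0$ for every dimension $n\ge 2$. -/

import Mathlib

open scoped NNReal

noncomputable section

/-- The `n`-dimensional hyperbolic space of curvature `-1`, as the upper sheet
`{(x₀, x) ∈ ℝ × ℝⁿ | x₀ ² - ‖x‖ ² = 1, x₀ > 0}` of the hyperboloid. -/
def HypSpace (n : ℕ) : Type :=
  {x : ℝ × EuclideanSpace ℝ (Fin n) // 0 < x.1 ∧ x.1 ^ 2 - ‖x.2‖ ^ 2 = 1}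

namespace HypSpace

/-- The hyperbolic distance `arcosh (x₀ y₀ - ⟨x, y⟩)`. -/
def hdist {n : ℕ} (x y : HypSpace n) : ℝ :=
  Real.arcosh (x.1.1 * y.1.1 - inner ℝ x.1.2 y.1.2)

/-- The base point `(1, 0)` of the hyperboloid. -/
def origin (n : ℕ) : HypSpace n := ⟨(1, 0), by norm_num⟩

/-- The closed ball of radius `R` in `n`-dimensional hyperbolic space, centred at the base point. -/
def Ball (n : ℕ) (R : ℝ≥0) : Type := {x : HypSpace n // hdist x (origin n) ≤ R}

/-- The distance function of the closed ball, restricted from hyperbolic space. -/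
def ballDist (n : ℕ) (R : ℝ≥0) (x y : Ball n R) : ℝ := hdist x.1 y.1

instance (n : ℕ) (R : ℝ≥0) : Nonempty (Ball n R) :=
  ⟨⟨origin n, by simp [hdist, origin]⟩⟩

end HypSpace

/-- The true label of the couple `{u, v}` for the dissimilarity `dsim` and the threshold `θ`:
`+1` if `u` and `v` are similar (`dsim u v < θ`) and `-1` if they are dissimilar
(`dsim u v > θ`). -/
def trueLabel {V : Type*} (dsim : V → V → ℝ) (θ : ℝ) (u v : V) : SignType :=
  SignType.sign (θ - dsim u v)

/-- The margin condition for the couple `c` (a two-element set): similar entities are represented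
at distance `d` with `s d ≤ s θZ - 1`, dissimilar ones with `s d ≥ s θZ + 1`. -/
def MarginCondition {V Z : Type*} (dsim : V → V → ℝ) (θ : ℝ) (dZ : Z → Z → ℝ) (s : ℝ → ℝ)
    (θZ : ℝ) (φ : V → Z) (c : Finset V) : Prop :=
  ∀ u ∈ c, ∀ v ∈ c, u ≠ v →
    (trueLabel dsim θ u v = 1 → s (dZ (φ u) (φ v)) ≤ s θZ - 1) ∧
    (trueLabel dsim θ u v = -1 → s (dZ (φ u) (φ v)) ≥ s θZ + 1)

open Classical in
/-- The number of couples that violate the margin condition under the representation map `φ`. -/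
def violations {V Z : Type*} [Fintype V] (dsim : V → V → ℝ) (θ : ℝ) (dZ : Z → Z → ℝ)
    (s : ℝ → ℝ) (θZ : ℝ) (φ : V → Z) : ℕ :=
  ((Finset.powersetCard 2 (Finset.univ : Finset V)).filter
    fun c => ¬ MarginCondition dsim θ dZ s θZ φ c).card

/-- The minimum number of violated couples over all representation maps `V → Z`. -/
def vMin {V : Type*} [Fintype V] (dsim : V → V → ℝ) (θ : ℝ) (Z : Type*) [Nonempty Z]
    (dZ : Z → Z → ℝ) (s : ℝ → ℝ) (θZ : ℝ) : ℕ :=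
  sInf (Set.range fun φ : V → Z => violations dsim θ dZ s θZ φ)

/-- The dissimilarity given by the graph distance. -/
def graphDsim {V : Type*} (G : SimpleGraph V) (u v : V) : ℝ := (G.dist u v : ℝ)

end

/-! In the half-plane, put a vertex of depth `k` at height `t ^ k`, shifted from its parent by at
most the parent's height. As `t → 0`, neighbours are at distance at most `log (3 / t)`, other pairs
at least `log (δ ^ 2 / (8 * t ^ 2))`, which is about twice as much
(`SimpleGraph.IsTree.exists_halfPlane_embedding`). So the gap exceeds any bound, while far out `s`
gains `1` over a fixed length `M` (`ConvexOn.exists_add_one_le`); a threshold inside the gap then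
works. The half-plane sits in every hyperbolic space of dimension at least `2` with the same
distances to the base point (`HypSpace.exists_halfPlane_embedding`), so `R` and the threshold do not
depend on `n`. -/

/-! ### Rooted trees -/

/-- A geodesic from the root to `v` in a tree ends with the only edge from `v` to a vertex which is
closer to the root. -/
lemma SimpleGraph.IsTree.eq_of_adj_of_dist_eq {V : Type*} {G : SimpleGraph V} (hG : G.IsTree)
    {r a b v : V} (ha : G.Adj a v) (hb : G.Adj b v) (hav : G.dist r v = G.dist r a + 1)
    (hbv : G.dist r v = G.dist r b + 1) : a = b := by
  obtain ⟨p, hp⟩ := hG.connected.exists_walk_length_eq_dist r a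
  obtain ⟨q, hq⟩ := hG.connected.exists_walk_length_eq_dist r b
  have hp' : (p.concat ha).IsPath := SimpleGraph.Walk.isPath_of_length_eq_dist _ (by
    rw [SimpleGraph.Walk.length_concat]; omega)
  have hq' : (q.concat hb).IsPath := SimpleGraph.Walk.isPath_of_length_eq_dist _ (by
    rw [SimpleGraph.Walk.length_concat]; omega)
  have h := (hG.existsUnique_path r v).unique hp' hq'
  simpa using congrArg SimpleGraph.Walk.penultimate h

/-- In a connected graph, a vertex other than the root has a neighbour which is closer to the root. -/
lemma SimpleGraph.Connected.exists_adj_dist_eq {V : Type*} {G : SimpleGraph V} (hG : G.Connected)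
    {r v : V} {n : ℕ} (hv : G.dist r v = n + 1) : ∃ a, G.Adj a v ∧ G.dist r a = n := by
  obtain ⟨p, hp⟩ := hG.exists_walk_length_eq_dist v r
  rw [SimpleGraph.dist_comm, hv] at hp
  cases p with
  | nil => simp at hp
  | @cons _ a _ h q =>
    refine ⟨a, h.symm, ?_⟩
    have h1 : G.dist a r ≤ q.length := SimpleGraph.dist_le q
    have h2 : G.dist r v ≤ G.dist r a + G.dist a v := hG.dist_triangle
    have h3 : G.dist a v = 1 := SimpleGraph.dist_eq_one_iff_adj.mpr h.symm
    rw [SimpleGraph.dist_comm] at h1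
    simp only [SimpleGraph.Walk.length_cons] at hp
    omega

/-- A tree can be described by the depth and the parent of its vertices. -/
lemma SimpleGraph.IsTree.exists_depth_parent {V : Type*} {G : SimpleGraph V} (hG : G.IsTree) :
    ∃ (depth : V → ℕ) (par : V → V), (∀ v n, depth v = n + 1 → depth (par v) = n) ∧
      (∀ u v, depth u = 0 → depth v = 0 → u = v) ∧
      ∀ u v, G.Adj u v ↔
        (depth v = depth u + 1 ∧ par v = u) ∨ (depth u = depth v + 1 ∧ par u = v) := by
  obtain ⟨r⟩ := hG.connected.nonempty
  have H : ∀ v, ∃ a, ∀ n, G.dist r v = n + 1 → G.Adj a v ∧ G.dist r a = n := by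
    intro v
    rcases h : G.dist r v with _ | n
    · exact ⟨v, fun n hn => by omega⟩
    · obtain ⟨a, ha, hn⟩ := hG.connected.exists_adj_dist_eq h
      exact ⟨a, fun m hm => ⟨ha, by omega⟩⟩
  choose par hpar using H
  have key : ∀ u v, G.Adj u v → G.dist r v = G.dist r u + 1 → par v = u := fun u v h hd =>
    hG.eq_of_adj_of_dist_eq (r := r) (hpar v _ hd).1 h (by rw [(hpar v _ hd).2, hd]) hd
  refine ⟨G.dist r, par, fun v n h => (hpar v n h).2, fun u v hu hv => ?_, fun u v => ⟨?_, ?_⟩⟩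
  · rw [hG.connected.dist_eq_zero_iff] at hu hv
    exact hu.symm.trans hv
  · intro h
    rcases hG.dist_eq_dist_add_one_of_adj r h with hd | hd
    · exact Or.inr ⟨hd, key v u h.symm hd⟩
    · exact Or.inl ⟨hd, key u v h hd⟩
  · rintro (⟨hd, rfl⟩ | ⟨hd, rfl⟩)
    · exact (hpar v _ hd).1
    · exact (hpar u _ hd).1.symm

/-! ### Trees in the upper half-plane -/

/-- The hyperbolic cosine of the distance between two points of the upper half-plane. -/
noncomputable def halfPlaneCosh (x y x' y' : ℝ) : ℝ := ((x - x') ^ 2 + y ^ 2 + y' ^ 2) / (2 * (y * y'))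

lemma halfPlaneCosh_comm (x y x' y' : ℝ) : halfPlaneCosh x y x' y' = halfPlaneCosh x' y' x y := by
  unfold halfPlaneCosh
  rw [mul_comm y y']
  congr 1
  ring

lemma one_le_halfPlaneCosh {x y x' y' : ℝ} (hy : 0 < y) (hy' : 0 < y') :
    1 ≤ halfPlaneCosh x y x' y' := by
  unfold halfPlaneCosh
  rw [le_div_iff₀ (by positivity)]
  nlinarith [sq_nonneg (x - x'), sq_nonneg (y - y')]

/-- Abscissae for the vertices of a rooted forest: a child is shifted from its parent by a
multiple of the height of the parent. -/
lemma exists_abscissa {V : Type*} (depth : V → ℕ) (par : V → V)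
    (hpar : ∀ v n, depth v = n + 1 → depth (par v) = n) (o : V → ℝ) (t : ℝ) :
    ∃ x : V → ℝ, ∀ v n, depth v = n + 1 → x v = x (par v) + o v * t ^ n := by
  -- Recursion on a separate level counter avoids well-founded recursion on depth.
  let f : ℕ → V → ℝ := fun n => Nat.rec (fun _ => 0) (fun n g v => g (par v) + o v * t ^ n) n
  refine ⟨fun v => f (depth v) v, fun v n h => ?_⟩
  simp only [h, hpar v n h]
  rfl

/-- Distinct vertices of the same depth are far apart, relative to the height of their branching
point. -/
lemma abscissa_separation {V : Type*} {depth : V → ℕ} {par : V → V} {o x : V → ℝ} {t δ : ℝ}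
    (hpar : ∀ v n, depth v = n + 1 → depth (par v) = n)
    (hroot : ∀ u v, depth u = 0 → depth v = 0 → u = v)
    (hx : ∀ v n, depth v = n + 1 → x v = x (par v) + o v * t ^ n)
    (ho : ∀ v, o v ∈ Set.Icc (0 : ℝ) 1) (hoδ : ∀ u v, u ≠ v → δ ≤ |o u - o v|)
    (ht : 0 < t) (ht2 : t ≤ 1 / 2) (n : ℕ) (u v : V) (hu : depth u = n) (hv : depth v = n)
    (huv : u ≠ v) :
    ∃ k < n, δ * t ^ k - 2 * t ^ (k + 1) + 2 * t ^ n ≤ |x u - x v| := by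
  -- The summand `2 * t ^ n` is slack: passing to children costs at most `t ^ n`, and the remaining
  -- `t ^ n` is at least `2 * t ^ (n + 1)`.
  induction n generalizing u v with
  | zero => exact absurd (hroot u v hu hv) huv
  | succ n ih =>
    have hxu := hx u n hu
    have hxv := hx v n hv
    have htn : 0 < t ^ n := by positivity
    by_cases hp : par u = par v
    · refine ⟨n, n.lt_succ_self, ?_⟩
      have : x u - x v = (o u - o v) * t ^ n := by rw [hxu, hxv, hp]; ring
      rw [this, abs_mul, abs_of_pos htn]
      have := mul_le_mul_of_nonneg_right (hoδ u v huv) htn.le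
      linarith
    · obtain ⟨k, hk, hle⟩ := ih _ _ (hpar u n hu) (hpar v n hv) hp
      refine ⟨k, hk.trans n.lt_succ_self, ?_⟩
      have hd : |o v - o u| ≤ 1 := by
        have := ho u; have := ho v
        simp only [Set.mem_Icc] at *
        rw [abs_le]; constructor <;> linarith
      have h1 : |x (par u) - x (par v)| ≤ |x u - x v| + |(o v - o u) * t ^ n| := by
        have : x (par u) - x (par v) = (x u - x v) + (o v - o u) * t ^ n := by
          rw [hxu, hxv]; ring
        rw [this]; exact abs_add_le _ _
      rw [abs_mul, abs_of_pos htn] at h1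
      have h2 : |o v - o u| * t ^ n ≤ t ^ n := mul_le_of_le_one_left htn.le hd
      have h3 : t ^ (n + 1) ≤ t ^ n * (1 / 2) := by
        rw [pow_succ]; exact mul_le_mul_of_nonneg_left ht2 htn.le
      linarith

/-- A lower bound for the distance of two vertices that are horizontally separated at the scale of
a common ancestor. -/
lemma le_halfPlaneCosh_of_separation {x x' t δ : ℝ} {a b k : ℕ} (ht : 0 < t) (ht1 : t ≤ 1)
    (hδ : 0 < δ) (ha : k + 1 ≤ a) (hb : k + 1 ≤ b) (h : δ / 2 * t ^ k ≤ |x - x'|) :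
    δ ^ 2 / (8 * t ^ 2) ≤ halfPlaneCosh x (t ^ a) x' (t ^ b) := by
  unfold halfPlaneCosh
  have h1 : t ^ a * t ^ b ≤ t ^ (k + 1) * t ^ (k + 1) := by
    gcongr ?_ * ?_
    · exact pow_le_pow_of_le_one ht.le ht1 ha
    · exact pow_le_pow_of_le_one ht.le ht1 hb
  have h2 : (δ / 2 * t ^ k) ^ 2 ≤ (x - x') ^ 2 := by
    rw [← sq_abs (x - x')]; gcongr
  rw [div_le_div_iff₀ (by positivity) (by positivity)]
  calc δ ^ 2 * (2 * (t ^ a * t ^ b)) ≤ δ ^ 2 * (2 * (t ^ (k + 1) * t ^ (k + 1))) := by gcongr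
    _ = (δ / 2 * t ^ k) ^ 2 * (8 * t ^ 2) := by ring
    _ ≤ (x - x') ^ 2 * (8 * t ^ 2) := by gcongr
    _ ≤ _ := by gcongr; nlinarith [sq_nonneg (t ^ a), sq_nonneg (t ^ b)]

/-- A lower bound for the distance of two vertices whose heights differ by two levels. -/
lemma le_halfPlaneCosh_of_depth {x x' t δ : ℝ} {a b : ℕ} (ht : 0 < t) (ht1 : t ≤ 1)
    (hδ : 0 < δ) (hδ1 : δ ≤ 1) (hab : a + 2 ≤ b) :
    δ ^ 2 / (8 * t ^ 2) ≤ halfPlaneCosh x (t ^ a) x' (t ^ b) := by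
  unfold halfPlaneCosh
  have h1 : t ^ a * t ^ b ≤ t ^ a * t ^ (a + 2) := by
    gcongr ?_ * ?_
    exact pow_le_pow_of_le_one ht.le ht1 hab
  have h2 : δ ^ 2 ≤ 1 := pow_le_one₀ hδ.le hδ1
  rw [div_le_div_iff₀ (by positivity) (by positivity)]
  calc δ ^ 2 * (2 * (t ^ a * t ^ b)) ≤ 1 * (2 * (t ^ a * t ^ (a + 2))) := by gcongr
    _ = (t ^ a) ^ 2 * (2 * t ^ 2) := by ring
    _ ≤ (t ^ a) ^ 2 * (8 * t ^ 2) := by gcongr; norm_num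
    _ ≤ _ := by gcongr; nlinarith [sq_nonneg (x - x'), sq_nonneg (t ^ b)]

/-- An upper bound for the distance of a vertex and its parent. -/
lemma halfPlaneCosh_child_le {x o t : ℝ} {n : ℕ} (ht : 0 < t) (ht1 : t ≤ 1)
    (ho : o ∈ Set.Icc (0 : ℝ) 1) :
    halfPlaneCosh (x + o * t ^ n) (t ^ (n + 1)) x (t ^ n) ≤ 3 / (2 * t) := by
  have hn : 0 < t ^ n := by positivity
  have h : halfPlaneCosh (x + o * t ^ n) (t ^ (n + 1)) x (t ^ n) = (o ^ 2 + t ^ 2 + 1) / (2 * t) := by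
    unfold halfPlaneCosh
    field_simp
    ring
  rw [h]
  gcongr
  have := pow_le_one₀ ho.1 ho.2 (n := 2)
  have := pow_le_one₀ ht.le ht1 (n := 2)
  linarith

/-- Placement of a rooted tree in the upper half-plane, with parameter `t`: neighbours are at
distance at most about `log (1 / t)`, all other couples at distance at least about
`2 * log (1 / t)`. -/
lemma SimpleGraph.IsTree.exists_halfPlane_embedding {V : Type*} [Fintype V] {G : SimpleGraph V}
    (hG : G.IsTree) :
    ∃ δ : ℝ, 0 < δ ∧ δ ≤ 1 ∧ ∀ t : ℝ, 0 < t → t ≤ δ / 4 →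
      ∃ x y : V → ℝ, (∀ v, 0 < y v) ∧
        (∀ u v, G.Adj u v → halfPlaneCosh (x u) (y u) (x v) (y v) ≤ 3 / (2 * t)) ∧
        ∀ u v, u ≠ v → ¬ G.Adj u v →
          δ ^ 2 / (8 * t ^ 2) ≤ halfPlaneCosh (x u) (y u) (x v) (y v) := by
  obtain ⟨depth, par, hpar, hroot, hadj⟩ := hG.exists_depth_parent
  have := hG.connected.nonempty
  have hN : (1 : ℝ) ≤ Fintype.card V := by exact_mod_cast Fintype.card_pos
  let e := Fintype.equivFin V
  -- Only siblings need distinct offsets; numbering all of `V` gives this with gap `δ = 1 / |V|`.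
  let o : V → ℝ := fun v => (e v : ℕ) / (Fintype.card V : ℝ)
  have ho : ∀ v, o v ∈ Set.Icc (0 : ℝ) 1 := fun v =>
    ⟨by positivity, div_le_one_of_le₀ (by exact_mod_cast (e v).2.le) (by positivity)⟩
  set δ : ℝ := 1 / Fintype.card V with hδdef
  have hδ : 0 < δ := by positivity
  have hδ1 : δ ≤ 1 := by rw [hδdef, div_le_one (by positivity)]; exact hN
  have hoδ : ∀ u v, u ≠ v → δ ≤ |o u - o v| := by
    intro u v huv
    have hne : ((e u : ℕ) : ℤ) - (e v : ℕ) ≠ 0 := fun h =>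
      huv (e.injective (Fin.ext (by omega)))
    have h1 : (1 : ℝ) ≤ |((e u : ℕ) : ℝ) - (e v : ℕ)| := by
      exact_mod_cast Int.one_le_abs hne
    simp only [o, hδdef]
    rw [← sub_div, abs_div, abs_of_pos (by positivity : (0 : ℝ) < Fintype.card V)]
    gcongr
  refine ⟨δ, hδ, hδ1, fun t ht htδ => ?_⟩
  have ht2 : t ≤ 1 / 2 := by linarith
  have ht1 : t ≤ 1 := by linarith
  obtain ⟨x, hx⟩ := exists_abscissa depth par hpar o t
  have hchild : ∀ u v, depth u = depth v + 1 → par u = v →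
      halfPlaneCosh (x u) (t ^ depth u) (x v) (t ^ depth v) ≤ 3 / (2 * t) := by
    intro u v hd hp
    rw [hx u _ hd, hd, hp]
    exact halfPlaneCosh_child_le ht ht1 (ho u)
  have hfar : ∀ u v, depth u ≤ depth v → u ≠ v → ¬ (depth v = depth u + 1 ∧ par v = u) →
      δ ^ 2 / (8 * t ^ 2) ≤ halfPlaneCosh (x u) (t ^ depth u) (x v) (t ^ depth v) := by
    intro u v hle huv hnp
    have hk : ∀ k : ℕ, δ / 2 * t ^ k ≤ δ * t ^ k - 2 * t ^ (k + 1) := by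
      intro k
      have : t * t ^ k ≤ δ / 4 * t ^ k := by gcongr
      rw [pow_succ]; linarith
    have htn : 0 < t ^ depth u := by positivity
    rcases hle.eq_or_lt with hd | hd
    · obtain ⟨k, hkn, h⟩ :=
        abscissa_separation hpar hroot hx ho hoδ ht ht2 (depth u) u v rfl hd.symm huv
      exact le_halfPlaneCosh_of_separation ht ht1 hδ hkn (hd ▸ hkn) (by linarith [hk k])
    · rcases (Nat.succ_le_of_lt hd).eq_or_lt with hd | hd
      -- Compare `u` with `par v`, at the same depth; the slack absorbs the shift from `par v` to
      -- `v`.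
      · have hp : par v ≠ u := fun h => hnp ⟨hd.symm, h⟩
        obtain ⟨k, hkn, h⟩ := abscissa_separation hpar hroot hx ho hoδ ht ht2 (depth u) u (par v)
          rfl (hpar v _ hd.symm) hp.symm
        refine le_halfPlaneCosh_of_separation ht ht1 hδ hkn (by omega) ?_
        have hxv := hx v _ hd.symm
        have h1 : |x u - x (par v)| ≤ |x u - x v| + |o v * t ^ depth u| := by
          have : x u - x (par v) = (x u - x v) + o v * t ^ depth u := by rw [hxv]; ring
          rw [this]; exact abs_add_le _ _
        rw [abs_mul, abs_of_pos htn, abs_of_nonneg (ho v).1] at h1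
        have h2 : o v * t ^ depth u ≤ t ^ depth u := mul_le_of_le_one_left htn.le (ho v).2
        linarith [hk k]
      · exact le_halfPlaneCosh_of_depth ht ht1 hδ hδ1 hd
  refine ⟨x, fun v => t ^ depth v, fun v => by positivity, fun u v h => ?_, fun u v huv h => ?_⟩
  · rcases (hadj u v).1 h with ⟨hd, hp⟩ | ⟨hd, hp⟩
    · rw [halfPlaneCosh_comm]; exact hchild v u hd hp
    · exact hchild u v hd hp
  · rw [hadj, not_or] at h
    rcases le_total (depth u) (depth v) with hle | hle
    · exact hfar u v hle huv h.1
    · rw [halfPlaneCosh_comm]; exact hfar v u hle huv.symm h.2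

/-! ### The upper half-plane in hyperbolic space -/

/-- The upper half-plane embeds into hyperbolic `n`-space for `2 ≤ n`, at a distance from the base
point that does not depend on `n`. -/
lemma HypSpace.exists_halfPlane_embedding {n : ℕ} (hn : 2 ≤ n) :
    ∃ F : ℝ → ∀ y : ℝ, 0 < y → HypSpace n,
      (∀ x y hy x' y' hy', HypSpace.hdist (F x y hy) (F x' y' hy') =
        Real.arcosh (halfPlaneCosh x y x' y')) ∧
      ∀ x y hy, HypSpace.hdist (F x y hy) (HypSpace.origin n) =
        Real.arcosh (halfPlaneCosh x y 0 1) := by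
  let i : Fin n := ⟨0, by omega⟩
  let j : Fin n := ⟨1, by omega⟩
  have hij : i ≠ j := by simp [i, j]
  let w : ℝ → ℝ → EuclideanSpace ℝ (Fin n) := fun a b =>
    EuclideanSpace.single i a + EuclideanSpace.single j b
  have hw : ∀ a b a' b', inner ℝ (w a b) (w a' b') = a * a' + b * b' := by
    intro a b a' b'
    simp [w, inner_add_left, inner_add_right, EuclideanSpace.inner_single_left, hij, hij.symm]
  -- The standard isometry onto the hyperboloid, sending `(0, 1)` to the base point; all coordinates
  -- beyond the first two vanish.
  refine ⟨fun x y hy => ⟨((x ^ 2 + y ^ 2 + 1) / (2 * y),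
    w ((x ^ 2 + y ^ 2 - 1) / (2 * y)) (x / y)), by positivity, ?_⟩, ?_, ?_⟩
  · rw [← real_inner_self_eq_norm_sq, hw]
    field_simp
    ring
  · intro x y hy x' y' hy'
    simp only [HypSpace.hdist, hw, halfPlaneCosh]
    congr 1
    field_simp
    ring
  · intro x y hy
    simp [HypSpace.hdist, HypSpace.origin, halfPlaneCosh]

lemma Real.arcosh_le_log_two_mul {x : ℝ} (hx : 1 ≤ x) : Real.arcosh x ≤ Real.log (2 * x) := by
  unfold Real.arcosh
  apply Real.log_le_log (by positivity)
  have : √(x ^ 2 - 1) ≤ x := by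
    rw [Real.sqrt_le_left (by positivity)]; linarith
  linarith

lemma Real.log_le_arcosh {x : ℝ} (hx : 1 ≤ x) : Real.log x ≤ Real.arcosh x := by
  unfold Real.arcosh
  apply Real.log_le_log (by positivity)
  linarith [Real.sqrt_nonneg (x ^ 2 - 1)]

/-! ### Convex functions -/

/-- A non-decreasing non-constant convex function eventually grows by at least `1` on every
interval of a suitable length. -/
lemma ConvexOn.exists_add_one_le {s : ℝ → ℝ} (hs_mono : MonotoneOn s (Set.Ici 0))
    (hs_conv : ConvexOn ℝ (Set.Ici 0) s)
    (hs_nonconst : ∃ x ∈ Set.Ici (0 : ℝ), ∃ y ∈ Set.Ici (0 : ℝ), s x ≠ s y) :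
    ∃ M > 0, ∃ b ≥ 0, ∀ z ≥ b, s z + 1 ≤ s (z + M) := by
  obtain ⟨x, y, hx, hxy, hs⟩ : ∃ x y : ℝ, 0 ≤ x ∧ x < y ∧ s x < s y := by
    obtain ⟨x, hx, y, hy, hne⟩ := hs_nonconst
    have key : ∀ x y : ℝ, 0 ≤ x → 0 ≤ y → s x < s y → x < y := fun x y hx hy h => by
      by_contra! hle
      exact absurd (hs_mono hy hx hle) (not_le.2 h)
    rcases lt_or_gt_of_ne hne with h | h
    · exact ⟨x, y, hx, key x y hx hy h, h⟩
    · exact ⟨y, x, hy, key y x hy hx h, h⟩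
  have hM : 0 < (y - x) / (s y - s x) := div_pos (sub_pos.2 hxy) (sub_pos.2 hs)
  -- `M` is the inverse of a positive secant slope; by convexity, slopes beyond `y` are no smaller.
  refine ⟨(y - x) / (s y - s x), hM, y, by linarith, fun z hz => ?_⟩
  set M := (y - x) / (s y - s x) with hMdef
  have h0 : 0 ≤ z := by linarith
  have h1 : (s y - s x) / (y - x) ≤ (s z - s x) / (z - x) :=
    hs_conv.secant_mono hx (by simp; linarith) h0 hxy.ne' (by linarith) hz
  have h2 : (s z - s x) / (z - x) ≤ (s (z + M) - s z) / (z + M - z) :=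
    hs_conv.slope_mono_adjacent hx (by simp; linarith) (by linarith) (by linarith)
  have h3 := h1.trans h2
  rw [← inv_div (y - x), ← hMdef, add_sub_cancel_left, le_div_iff₀ hM, inv_mul_cancel₀ hM.ne'] at h3
  linarith

/-! ### Representations without violated couples -/

/-- Connectedness matters: `SimpleGraph.dist` is `0` between unreachable vertices, which would label
them similar. -/
lemma vMin_eq_zero_of_forall {V : Type*} [Fintype V] {G : SimpleGraph V} (hG : G.Connected)
    {Z : Type*} [Nonempty Z] {dZ : Z → Z → ℝ} {s : ℝ → ℝ} {θZ : ℝ} (φ : V → Z)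
    (hadj : ∀ u v, G.Adj u v → s (dZ (φ u) (φ v)) ≤ s θZ - 1)
    (hnadj : ∀ u v, u ≠ v → ¬ G.Adj u v → s θZ + 1 ≤ s (dZ (φ u) (φ v))) :
    vMin (graphDsim G) (3 / 2) Z dZ s θZ = 0 := by
  refine Nat.le_zero.1 (Nat.sInf_le ⟨φ, ?_⟩)
  simp only [violations, Finset.card_eq_zero, Finset.filter_eq_empty_iff, not_not]
  intro c _ u _ v _ huv
  refine ⟨fun h => hadj u v ?_, fun h => hnadj u v huv fun ha => ?_⟩
  · rw [trueLabel, sign_eq_one_iff, graphDsim] at h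
    have h1 : (G.dist u v : ℝ) < (2 : ℕ) := by push_cast; linarith
    have h2 : G.dist u v < 2 := by exact_mod_cast h1
    have h3 := hG.pos_dist_of_ne huv
    exact SimpleGraph.dist_eq_one_iff_adj.1 (by omega)
  · rw [trueLabel, sign_eq_neg_one_iff, graphDsim, SimpleGraph.dist_eq_one_iff_adj.2 ha] at h
    norm_num at h

theorem lemma3 {V : Type*} [Fintype V] (G : SimpleGraph V) (hG : G.IsTree)
    (s : ℝ → ℝ) (hs_mono : MonotoneOn s (Set.Ici 0)) (hs_conv : ConvexOn ℝ (Set.Ici 0) s)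
    (hs_nonconst : ∃ x ∈ Set.Ici (0 : ℝ), ∃ y ∈ Set.Ici (0 : ℝ), s x ≠ s y) :
    ∃ R : ℝ≥0, ∃ θZ ∈ Set.Icc (0 : ℝ) (2 * R), ∀ n : ℕ, 2 ≤ n →
      vMin (graphDsim G) (3 / 2) (HypSpace.Ball n R) (HypSpace.ballDist n R) s θZ = 0 := by
  obtain ⟨M, hM, b, hb, hgrow⟩ := hs_conv.exists_add_one_le hs_mono hs_nonconst
  obtain ⟨δ, hδ, hδ1, hemb⟩ := hG.exists_halfPlane_embedding
  -- The last two bounds give `b ≤ log (3 / t)` and a gap of at least `2 * M`, with `θ` at distance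
  -- `M` above its lower end.
  obtain ⟨t, ht, ht1, ht2, ht3⟩ : ∃ t : ℝ, 0 < t ∧ t ≤ δ / 4 ∧ t ≤ 3 * Real.exp (-b) ∧
      t ≤ δ ^ 2 / 24 * Real.exp (-(2 * M)) :=
    ⟨min (δ / 4) (min (3 * Real.exp (-b)) (δ ^ 2 / 24 * Real.exp (-(2 * M)))), by positivity,
      min_le_left _ _, (min_le_right _ _).trans (min_le_left _ _),
      (min_le_right _ _).trans (min_le_right _ _)⟩
  obtain ⟨x, y, hy, hadj, hnadj⟩ := hemb t ht ht1
  have hnear : b ≤ Real.log (3 / t) := by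
    rw [Real.le_log_iff_exp_le (by positivity), le_div_iff₀ ht]
    calc Real.exp b * t ≤ Real.exp b * (3 * Real.exp (-b)) := by gcongr
      _ = 3 := by rw [mul_left_comm, ← Real.exp_add]; simp
  have hfar : Real.log (3 / t) + M + M ≤ Real.log (δ ^ 2 / (8 * t ^ 2)) := by
    rw [add_assoc, ← two_mul, ← Real.log_exp (2 * M),
      ← Real.log_mul (by positivity) (Real.exp_ne_zero _)]
    apply Real.log_le_log (by positivity)
    rw [le_div_iff₀ (by positivity)]
    calc 3 / t * Real.exp (2 * M) * (8 * t ^ 2) = 24 * Real.exp (2 * M) * t := by field_simp; ring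
      _ ≤ 24 * Real.exp (2 * M) * (δ ^ 2 / 24 * Real.exp (-(2 * M))) := by gcongr
      _ = δ ^ 2 * (Real.exp (2 * M) * Real.exp (-(2 * M))) := by ring
      _ = δ ^ 2 := by rw [← Real.exp_add]; simp
  set θ := Real.log (3 / t) + M with hθ
  have hθ0 : 0 ≤ θ := by linarith
  let r : V → ℝ := fun v => Real.arcosh (halfPlaneCosh (x v) (y v) 0 1)
  have hr : ∀ v, 0 ≤ r v := fun v => Real.arcosh_nonneg (one_le_halfPlaneCosh (hy v) one_pos)
  have hsum : 0 ≤ ∑ v, r v := Finset.sum_nonneg fun v _ => hr v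
  -- The sum crudely bounds every `r v`; adding `θ` ensures `θ ≤ 2 * R`.
  refine ⟨NNReal.mk (θ + ∑ v, r v) (by positivity), θ, ⟨hθ0, ?_⟩, fun n hn => ?_⟩
  · rw [NNReal.coe_mk]; linarith
  obtain ⟨F, hF, hF0⟩ := HypSpace.exists_halfPlane_embedding hn
  refine vMin_eq_zero_of_forall hG.connected (fun v => ⟨F (x v) (y v) (hy v), ?_⟩) ?_ ?_
  · rw [hF0, NNReal.coe_mk]
    have := Finset.single_le_sum (fun v _ => hr v) (Finset.mem_univ v)
    change r v ≤ _
    linarith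
  · intro u v huv
    have h1 := one_le_halfPlaneCosh (x := x u) (x' := x v) (hy u) (hy v)
    have h2 : Real.arcosh (halfPlaneCosh (x u) (y u) (x v) (y v)) ≤ Real.log (3 / t) := by
      refine (Real.arcosh_le_log_two_mul h1).trans (Real.log_le_log (by positivity) ?_)
      calc _ ≤ 2 * (3 / (2 * t)) := by gcongr; exact hadj u v huv
        _ = 3 / t := by field_simp
    have h3 := hs_mono (Real.arcosh_nonneg h1) (hb.le.trans hnear) h2
    have h4 := hgrow _ hnear
    simp only [HypSpace.ballDist, hF]
    linarith
  · intro u v huv hn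
    have h1 := one_le_halfPlaneCosh (x := x u) (x' := x v) (hy u) (hy v)
    have h2 : θ + M ≤ Real.arcosh (halfPlaneCosh (x u) (y u) (x v) (y v)) :=
      hfar.trans ((Real.log_le_log (by positivity) (hnadj u v huv hn)).trans
        (Real.log_le_arcosh h1))
    have h3 := hs_mono (Set.mem_Ici.2 (by positivity)) (Real.arcosh_nonneg h1) h2
    have h4 := hgrow θ (by linarith)
    simp only [HypSpace.ballDist, hF]
    linarith
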